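/- Let $(\Omega,\mathscr F,P)$ be a probability space and let, for some integers $d,r\ge 0$, $(X_{-r+1},Y_{-r+1}),\dots,(X_0,Y_0),(X_1,Y_1),(X_2,Y_2),\dots$ be an exchangeable sequence of random pairs with values in $\mathbb R^d\times\mathbb R$ (for every $N$, the joint law of the first $N$ pairs is invariant under all permutations of these pairs). Let $\mathscr T=\sigma((X_{-r+1},Y_{-r+1}),\dots,(X_0,Y_0))$ be the $\sigma$-field of the training sample (trivial if $r=0$). Let $\rho:\mathbb R^d\times\mathbb R\times\Omega\to[0,\infty)$ be a conformity function, that is, a function measurable with respect to the product of the Borel $\sigma$-field of $\mathbb R^d\times\mathbb R$ and $\mathscr T$. Let $R_i(\omega)=\rho(X_i(\omega),Y_i(\omega),\omega)$, $i\ge 1$, be the conformity scores, and assume that almost surely they are pairwise distinct. For a nominal miscoverage level $0<\alpha<1$ and a calibration sample size $n\ge1$, put $b=\lceil(1-\alpha)(n+1)\rceil$ and $g=\lfloor\alpha(n+1)\rfloor$. Let $R_{(1)}\le\dots\le R_{(n)}$ be $R_1,\dots,R_n$ in increasing order, with the convention $R_{(n+1)}=+\infty$, and let $$D(x,\omega)=\{y\in\mathbb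 R:\rho(x,y,\omega)<R_{(b)}(\omega)\}.$$ For $m\ge 1$ let $C_m=\frac1m\sum_{i=1}^m Z_i$, where $Z_i=1$ if $Y_{n+i}\in D(X_{n+i})$ and $Z_i=0$ otherwise. Then, for every $0<\alpha<1$ and every $n\ge1$, $C_m$ converges almost surely as $m\to\infty$ to a random variable $C_\infty$ whose distribution is $\mathrm{Beta}(b,g)$, where in the degenerate case $g=0$ (that is, $\alpha(n+1)<1$, equivalently $b=n+1$) $\mathrm{Beta}(n+1,0)$ denotes the point mass at $1$. -/

import Mathlib

open MeasureTheory ProbabilityTheory Filter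
open scoped Topology NNReal ENNReal

namespace SplitConformal

/-- A sequence `O 0, O 1, …` of random objects on `(Ω, P)` is exchangeable if, for every `N` and every
permutation `π` of `{0, …, N - 1}`, the tuples `(O 0, …, O (N - 1))` and
`(O (π 0), …, O (π (N - 1)))` have the same distribution. -/
def Exchangeable {Ω S : Type*} [MeasurableSpace Ω] [MeasurableSpace S]
    (O : ℕ → Ω → S) (P : Measure Ω) : Prop :=
  ∀ (N : ℕ) (π : Equiv.Perm (Fin N)),
    IdentDistrib (fun ω (i : Fin N) => O i ω) (fun ω (i : Fin N) => O (π i) ω) P P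

/-- The σ-field generated by the training sample, which consists of the first `r` terms
`(X 0, Y 0), …, (X (r - 1), Y (r - 1))` of the data sequence. -/
@[reducible] def trainingSigma {Ω : Type*} {d : ℕ} (X : ℕ → Ω → EuclideanSpace ℝ (Fin d)) (Y : ℕ → Ω → ℝ)
    (r : ℕ) : MeasurableSpace Ω :=
  MeasurableSpace.comap (fun ω (i : Fin r) => (X i ω, Y i ω)) inferInstance

/-- `ρ : ℝ^d × ℝ × Ω → ℝ₊` is a conformity function with respect to the σ-field `𝒯` of the training
sample: it is measurable with respect to the product of the Borel σ-field of `ℝ^d × ℝ` and `𝒯`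
(so in particular `ρ x y` is `𝒯`-measurable for all `x`, `y`). -/
def IsConformityFunction {Ω : Type*} {d : ℕ} (𝒯 : MeasurableSpace Ω)
    (ρ : EuclideanSpace ℝ (Fin d) → ℝ → Ω → ℝ≥0) : Prop :=
  Measurable[MeasurableSpace.prod (inferInstance : MeasurableSpace (EuclideanSpace ℝ (Fin d) × ℝ)) 𝒯]
    (fun p : (EuclideanSpace ℝ (Fin d) × ℝ) × Ω => ρ p.1.1 p.1.2 p.2)

/-- The conformity scores: the `i`-th score (`i = 0, 1, …`) belongs to the `i`-th pair
after the training sample. -/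
def score {Ω : Type*} {d : ℕ} (X : ℕ → Ω → EuclideanSpace ℝ (Fin d)) (Y : ℕ → Ω → ℝ) (r : ℕ)
    (ρ : EuclideanSpace ℝ (Fin d) → ℝ → Ω → ℝ≥0) (i : ℕ) (ω : Ω) : ℝ≥0 :=
  ρ (X (r + i) ω) (Y (r + i) ω) ω

/-- The `k`-th smallest (`k = 1, 2, …`) of the numbers `v 0, …, v (n - 1)`, counted with multiplicity,
with the convention that it is `∞` when `k > n`. -/
noncomputable def orderStat {n : ℕ} (v : Fin n → ℝ≥0) (k : ℕ) : ℝ≥0∞ :=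
  if h : k - 1 < n then ((v (Tuple.sort v ⟨k - 1, h⟩) : ℝ≥0) : ℝ≥0∞) else ⊤

/-- The conformal prediction set at `x`: all `y` with `ρ(x, y)` strictly smaller than the
`⌈(1 - α)(n + 1)⌉`-th smallest of the `n` calibration scores. -/
def predictionSet {Ω : Type*} {d : ℕ} (X : ℕ → Ω → EuclideanSpace ℝ (Fin d)) (Y : ℕ → Ω → ℝ)
    (r : ℕ) (ρ : EuclideanSpace ℝ (Fin d) → ℝ → Ω → ℝ≥0) (n : ℕ) (α : ℝ)
    (x : EuclideanSpace ℝ (Fin d)) (ω : Ω) : Set ℝ :=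
  {y | (ρ x y ω : ℝ≥0∞) <
    orderStat (fun i : Fin n => score X Y r ρ i ω) ⌈(1 - α) * ((n : ℝ) + 1)⌉₊}

open Classical in
/-- The indicator that the `i`-th future response (`i = 0, 1, …`), which comes after the `r` training
and the `n` calibration pairs, lies in its prediction set. -/
noncomputable def coverIndicator {Ω : Type*} {d : ℕ} (X : ℕ → Ω → EuclideanSpace ℝ (Fin d))
    (Y : ℕ → Ω → ℝ) (r : ℕ) (ρ : EuclideanSpace ℝ (Fin d) → ℝ → Ω → ℝ≥0) (n : ℕ) (α : ℝ)
    (i : ℕ) (ω : Ω) : ℝ :=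
  if Y (r + n + i) ω ∈ predictionSet X Y r ρ n α (X (r + n + i) ω) ω then 1 else 0

/-- The future coverage for a horizon of `m` future observables. -/
noncomputable def coverage {Ω : Type*} {d : ℕ} (X : ℕ → Ω → EuclideanSpace ℝ (Fin d))
    (Y : ℕ → Ω → ℝ) (r : ℕ) (ρ : EuclideanSpace ℝ (Fin d) → ℝ → Ω → ℝ≥0) (n : ℕ) (α : ℝ)
    (m : ℕ) (ω : Ω) : ℝ :=
  (1 / (m : ℝ)) * ∑ i ∈ Finset.range m, coverIndicator X Y r ρ n α i ω

/-- The distribution `Beta(b, g)` for integers `b ≥ 1`, `g ≥ 0`, where `Beta(b, 0)` is the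
degenerate beta distribution, i.e. the point mass at `1`. -/
noncomputable def betaLaw (b g : ℕ) : Measure ℝ :=
  if g = 0 then Measure.dirac 1 else betaMeasure b g

end SplitConformal

namespace SplitConformal

/-! A conformity function depends on ω only through the training sample, so the scores are again
exchangeable. A future response is covered exactly when fewer than `b` calibration scores are at
most its own score (`lowRank`). For `k` given future scores this holds simultaneously iff all of
them lie among the `b + k - 1` smallest of the `n + k` scores concerned. By exchangeability the set
of these smallest scores is a uniformly distributed subset, so the probability is `(b + k -
1).choose k / (n + k).choose k` (`measureReal_iInter_lowRank`).

Since this depends on `k` alone, a de Finetti type argument applies (`exists_tendsto_average`): an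
L² estimate gives almost sure convergence of the frequencies, and the expectation of `choose (count)
k` identifies the `k`-th moment of the limit with that probability. These are the moments of the
beta law (`integral_pow_betaLaw`), and moments determine a law on the unit interval
(`ext_of_moments_eq`). -/

open Classical in
/-- The number of the events `S 0, …, S (m - 1)` that occur at `ω`. -/
noncomputable def occurrences {Ω : Type*} (S : ℕ → Set Ω) (m : ℕ) (ω : Ω) : ℕ :=
  ((Finset.range m).filter fun i => ω ∈ S i).card

/-! ### Counts of occurring events and their limiting frequencies. -/

section Counting

variable {Ω : Type*} {S : ℕ → Set Ω}

lemma occurrences_le (m : ℕ) (ω : Ω) : occurrences S m ω ≤ m := by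
  classical
  exact (Finset.card_filter_le _ _).trans_eq (Finset.card_range m)

lemma monotone_occurrences (ω : Ω) : Monotone fun m => occurrences S m ω := by
  classical
  intro a b hab
  exact Finset.card_le_card (Finset.filter_subset_filter _ (Finset.range_mono hab))

lemma occurrences_eq_sum (m : ℕ) (ω : Ω) :
    (occurrences S m ω : ℝ) = ∑ i ∈ Finset.range m, (S i).indicator 1 ω := by
  classical
  simp only [occurrences, Set.indicator_apply, Pi.one_apply, Finset.sum_boole]

/-- Both sides count the `k`-sets of indices whose events all occur; taking expectations turns
intersection probabilities into binomial moments of the count. -/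
lemma choose_occurrences_eq_sum (m k : ℕ) (ω : Ω) :
    ((occurrences S m ω).choose k : ℝ) =
      ∑ A ∈ (Finset.range m).powersetCard k, (⋂ i ∈ A, S i).indicator 1 ω := by
  classical
  rw [occurrences, ← Finset.card_powersetCard]
  simp only [Set.indicator_apply, Pi.one_apply, Finset.sum_boole, Set.mem_iInter]
  congr 2
  ext A
  simp only [Finset.mem_powersetCard, Finset.mem_filter, Finset.subset_iff]
  grind

lemma average_mem_Icc (m : ℕ) (ω : Ω) : (occurrences S m ω : ℝ) / m ∈ Set.Icc (0 : ℝ) 1 := by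
  refine ⟨by positivity, div_le_one_of_le₀ ?_ (by positivity)⟩
  exact_mod_cast occurrences_le m ω

/-- The counts are monotone and the ratio of consecutive fourth powers tends to 1, so the averages
cannot oscillate between the terms of the subsequence. -/
lemma tendsto_average_of_tendsto_subsequence {ω : Ω} {c : ℝ}
    (h : Tendsto (fun k : ℕ => (occurrences S ((k + 1) ^ 4) ω : ℝ) / ((k + 1) ^ 4 : ℕ)) atTop
      (𝓝 c)) :
    Tendsto (fun m : ℕ => (occurrences S m ω : ℝ) / m) atTop (𝓝 c) := by
  refine tendsto_div_of_monotone_of_exists_subseq_tendsto_div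
    (fun m => (occurrences S m ω : ℝ)) c
    (fun a b hab => Nat.cast_le.2 (monotone_occurrences ω hab)) fun a ha => ?_
  refine ⟨fun k => (k + 1) ^ 4, ?_, ?_, h⟩
  · have hlim : Tendsto (fun k : ℕ => (1 + 1 / ((k : ℝ) + 1)) ^ 4) atTop (𝓝 1) := by
      simpa using (tendsto_one_div_add_atTop_nhds_zero_nat (𝕜 := ℝ)).const_add 1 |>.pow 4
    filter_upwards [hlim.eventually_lt_const ha] with k hk
    have hk0 : (0 : ℝ) < k + 1 := by positivity
    have : (((k + 1 + 1) ^ 4 : ℕ) : ℝ) =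
        (1 + 1 / ((k : ℝ) + 1)) ^ 4 * (((k + 1) ^ 4 : ℕ) : ℝ) := by
      push_cast
      rw [← mul_pow]
      congr 1
      field_simp
    rw [this]
    gcongr
  · exact (tendsto_pow_atTop (by norm_num)).comp (tendsto_add_atTop_nat 1)

lemma measurable_occurrences [MeasurableSpace Ω] (hS : ∀ i, MeasurableSet (S i)) (m : ℕ) :
    Measurable fun ω => (occurrences S m ω : ℝ) := by
  simp only [occurrences_eq_sum]
  exact Finset.measurable_sum _ fun i _ => measurable_one.indicator (hS i)

end Counting

lemma tendsto_descFactorial_div {s : ℕ → ℕ} {c : ℝ}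
    (h : Tendsto (fun m => (s m : ℝ) / m) atTop (𝓝 c)) (k : ℕ) :
    Tendsto (fun m => ((s m).descFactorial k : ℝ) / (m.descFactorial k : ℝ)) atTop
      (𝓝 (c ^ k)) := by
  induction k with
  | zero => simp
  | succ k ih =>
    have hinv : Tendsto (fun m : ℕ => (k : ℝ) / m) atTop (𝓝 0) :=
      tendsto_const_div_atTop_nhds_zero_nat _
    have hnum : Tendsto (fun m => ((s m - k : ℕ) : ℝ) / m) atTop (𝓝 c) := by
      -- The subtraction `s m - k` is truncated and `s m` may stay small (when `c = 0`), hence a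
      -- squeeze rather than an identity.
      have hlow : Tendsto (fun m => (s m : ℝ) / m - k / m) atTop (𝓝 c) := by
        simpa using h.sub hinv
      refine tendsto_of_tendsto_of_tendsto_of_le_of_le hlow h (fun m => ?_) fun m => ?_
      · simp only [← sub_div]
        gcongr
        have : s m ≤ (s m - k) + k := by omega
        have : (s m : ℝ) ≤ ((s m - k : ℕ) : ℝ) + k := by exact_mod_cast this
        linarith
      · simp only
        gcongr
        omega
    have hden : Tendsto (fun m : ℕ => ((m - k : ℕ) : ℝ) / m) atTop (𝓝 1) := by
      have : Tendsto (fun m : ℕ => 1 - (k : ℝ) / m) atTop (𝓝 1) := by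
        simpa using tendsto_const_nhds.sub hinv
      refine this.congr' ?_
      filter_upwards [eventually_ge_atTop k, eventually_gt_atTop 0] with m hm hm0
      rw [Nat.cast_sub hm]
      field_simp
    have hmain := (hnum.div hden one_ne_zero).mul ih
    rw [div_one, ← pow_succ'] at hmain
    refine hmain.congr' ?_
    filter_upwards [eventually_gt_atTop 0] with m hm0
    have : (m : ℝ) ≠ 0 := by positivity
    simp only [Pi.div_apply, Nat.descFactorial_succ, Nat.cast_mul]
    rw [div_div_div_cancel_right₀ this, div_mul_div_comm]

lemma tendsto_choose_div {s : ℕ → ℕ} {c : ℝ}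
    (h : Tendsto (fun m => (s m : ℝ) / m) atTop (𝓝 c)) (k : ℕ) :
    Tendsto (fun m => ((s m).choose k : ℝ) / (m.choose k : ℝ)) atTop (𝓝 (c ^ k)) := by
  refine (tendsto_descFactorial_div h k).congr fun m => ?_
  have : (k.factorial : ℝ) ≠ 0 := by positivity
  simp only [Nat.descFactorial_eq_factorial_mul_choose, Nat.cast_mul]
  rw [mul_div_mul_left _ _ this]

/-! ### Almost sure convergence of frequencies, and moments of the limit. -/

section Exchangeable

variable {Ω : Type*} [MeasurableSpace Ω] {P : Measure Ω}
  {S : ℕ → Set Ω} {p : ℕ → ℝ}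

lemma integral_choose_occurrences [IsProbabilityMeasure P] (hS : ∀ i, MeasurableSet (S i))
    (hp : ∀ A : Finset ℕ, P.real (⋂ i ∈ A, S i) = p A.card) (m k : ℕ) :
    ∫ ω, ((occurrences S m ω).choose k : ℝ) ∂P = m.choose k * p k := by
  have hmeas : ∀ A : Finset ℕ, MeasurableSet (⋂ i ∈ A, S i) := fun A =>
    A.measurableSet_biInter fun i _ => hS i
  simp only [choose_occurrences_eq_sum]
  rw [integral_finsetSum]
  · simp only [integral_indicator_one (hmeas _), hp]
    rw [Finset.sum_congr rfl fun A hA => by rw [(Finset.mem_powersetCard.1 hA).2]]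
    simp
  · exact fun A _ => (integrable_const (1 : ℝ)).indicator (hmeas A)

lemma integral_indicator_mul_indicator (hS : ∀ i, MeasurableSet (S i))
    (hp : ∀ A : Finset ℕ, P.real (⋂ i ∈ A, S i) = p A.card) (i j : ℕ) :
    ∫ ω, (S i).indicator 1 ω * (S j).indicator (1 : Ω → ℝ) ω ∂P =
      p 2 + if i = j then p 1 - p 2 else 0 := by
  have h : ∀ ω, (S i).indicator 1 ω * (S j).indicator (1 : Ω → ℝ) ω =
      (⋂ l ∈ ({i, j} : Finset ℕ), S l).indicator 1 ω := by
    intro ω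
    classical
    simp only [Set.indicator_apply, Finset.mem_insert, Finset.mem_singleton, Set.mem_iInter,
      forall_eq_or_imp, forall_eq, Pi.one_apply]
    by_cases h1 : ω ∈ S i <;> by_cases h2 : ω ∈ S j <;> simp [h1, h2]
  simp only [h]
  rw [integral_indicator_one (Finset.measurableSet_biInter _ fun i _ => hS i), hp]
  by_cases hij : i = j
  · simp [hij]
  · simp [hij]

lemma integral_sq_sum_indicator [IsProbabilityMeasure P] (hS : ∀ i, MeasurableSet (S i))
    (hp : ∀ A : Finset ℕ, P.real (⋂ i ∈ A, S i) = p A.card) (s : Finset ℕ) (a : ℕ → ℝ) :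
    ∫ ω, (∑ i ∈ s, a i * (S i).indicator 1 ω) ^ 2 ∂P =
      p 2 * (∑ i ∈ s, a i) ^ 2 + (p 1 - p 2) * ∑ i ∈ s, a i ^ 2 := by
  have hint : ∀ i j, Integrable
      (fun ω => (a i * a j) * ((S i).indicator 1 ω * (S j).indicator (1 : Ω → ℝ) ω)) P := by
    intro i j
    refine Integrable.const_mul ?_ _
    refine Integrable.of_bound (C := 1) ?_ (ae_of_all _ fun ω => ?_)
    · exact ((measurable_one.indicator (hS i)).mul
        (measurable_one.indicator (hS j))).aestronglyMeasurable
    · classical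
      simp only [Set.indicator_apply, Pi.one_apply]
      split_ifs <;> simp
  have h : ∀ ω, (∑ i ∈ s, a i * (S i).indicator 1 ω) ^ 2 = ∑ i ∈ s, ∑ j ∈ s,
      (a i * a j) * ((S i).indicator 1 ω * (S j).indicator (1 : Ω → ℝ) ω) := by
    intro ω
    rw [sq, Finset.sum_mul_sum]
    exact Finset.sum_congr rfl fun i _ => Finset.sum_congr rfl fun j _ => by ring
  simp only [h]
  rw [integral_finsetSum _ fun i _ => integrable_finsetSum _ fun j _ => hint i j]
  simp only [integral_finsetSum _ fun j _ => hint _ j, integral_const_mul,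
    integral_indicator_mul_indicator hS hp, mul_add, Finset.sum_add_distrib, mul_ite, mul_zero,
    Finset.sum_ite_eq]
  congr 1
  · rw [sq, Finset.sum_mul_sum, Finset.mul_sum]
    simp only [Finset.mul_sum]
    exact Finset.sum_congr rfl fun i _ => Finset.sum_congr rfl fun j _ => by ring
  · rw [Finset.mul_sum]
    exact Finset.sum_congr rfl fun i hi => by rw [if_pos hi]; ring

/-- The difference is a combination of indicators whose weights sum to zero. This kills the `p 2`
term of the second moment and leaves `(p 1 - p 2) * (1 / l - 1 / m)`. -/
lemma integral_sq_sub_average_le [IsProbabilityMeasure P] (hS : ∀ i, MeasurableSet (S i))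
    (hp : ∀ A : Finset ℕ, P.real (⋂ i ∈ A, S i) = p A.card) {l m : ℕ} (hl : 0 < l) (hlm : l ≤ m) :
    ∫ ω, ((occurrences S m ω : ℝ) / m - (occurrences S l ω : ℝ) / l) ^ 2 ∂P ≤ 1 / l := by
  have hm : 0 < m := hl.trans_le hlm
  have hl' : (0 : ℝ) < l := by exact_mod_cast hl
  have hm' : (0 : ℝ) < m := by exact_mod_cast hm
  have hrange : ∀ f : ℕ → ℝ, (∑ i ∈ Finset.range m, if i < l then f i else 0) =
      ∑ i ∈ Finset.range l, f i := by
    intro f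
    rw [← Finset.sum_filter]
    congr 1
    ext i
    simp only [Finset.mem_filter, Finset.mem_range]
    omega
  let a : ℕ → ℝ := fun i => 1 / m - if i < l then 1 / (l : ℝ) else 0
  have h : ∀ ω, (occurrences S m ω : ℝ) / m - (occurrences S l ω : ℝ) / l =
      ∑ i ∈ Finset.range m, a i * (S i).indicator 1 ω := by
    intro ω
    simp only [a, sub_mul, ite_mul, zero_mul, Finset.sum_sub_distrib, hrange, ← Finset.mul_sum,
      ← occurrences_eq_sum]
    ring
  have ha : ∑ i ∈ Finset.range m, a i = 0 := by
    simp only [a, Finset.sum_sub_distrib, hrange, Finset.sum_const, Finset.card_range, nsmul_eq_mul]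
    field_simp
    ring
  have ha2 : ∑ i ∈ Finset.range m, a i ^ 2 = 1 / l - 1 / m := by
    have : ∀ i, a i ^ 2 = 1 / m ^ 2 + if i < l then 1 / (l : ℝ) ^ 2 - 2 / (m * l) else 0 := by
      intro i
      simp only [a]
      split_ifs
      · field_simp
        ring
      · simp
    simp only [this, Finset.sum_add_distrib, hrange, Finset.sum_const, Finset.card_range,
      nsmul_eq_mul]
    field_simp
    ring
  simp only [h]
  rw [integral_sq_sum_indicator hS hp, ha, ha2]
  have hp1 : p 1 ≤ 1 := by
    have := hp {0}
    rw [Finset.card_singleton] at this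
    rw [← this]
    exact measureReal_le_one
  have hp2 : 0 ≤ p 2 := by
    have := hp {0, 1}
    rw [Finset.card_pair zero_ne_one] at this
    rw [← this]
    exact measureReal_nonneg
  have h1 : (0 : ℝ) ≤ 1 / l - 1 / m := by
    rw [sub_nonneg]
    gcongr
  have h2 : (0 : ℝ) ≤ 1 / m := by positivity
  nlinarith

/-- Along fourth powers the mean square increments are at most `(k + 1) ^ (-4)`, so they remain
summable after weighting by `(k + 1) ^ 2`. Almost surely the weighted squares are then summable, and
hence so are the increments themselves. -/
lemma ae_exists_tendsto_subsequence [IsProbabilityMeasure P] (hS : ∀ i, MeasurableSet (S i))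
    (hp : ∀ A : Finset ℕ, P.real (⋂ i ∈ A, S i) = p A.card) :
    ∀ᵐ ω ∂P, ∃ c : ℝ, Tendsto
      (fun k : ℕ => (occurrences S ((k + 1) ^ 4) ω : ℝ) / ((k + 1) ^ 4 : ℕ)) atTop (𝓝 c) := by
  let u : ℕ → Ω → ℝ := fun k ω => (occurrences S ((k + 1) ^ 4) ω : ℝ) / ((k + 1) ^ 4 : ℕ)
  let D : ℕ → Ω → ℝ := fun k ω => ((k : ℝ) + 1) ^ 2 * (u (k + 1) ω - u k ω) ^ 2
  have hu : ∀ k, Measurable (u k) := fun k => (measurable_occurrences hS _).div_const _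
  have hD : ∀ k, Measurable (D k) := fun k =>
    (((hu (k + 1)).sub (hu k)).pow_const 2).const_mul _
  have hsummable : Summable fun k : ℕ => 1 / ((k : ℝ) + 1) ^ 2 := by
    have := (summable_nat_add_iff 1).2 (Real.summable_one_div_nat_pow.2 (by norm_num : 1 < 2))
    simpa using this
  have hDint : ∀ k, ∫⁻ ω, ENNReal.ofReal (D k ω) ∂P ≤ ENNReal.ofReal (1 / ((k : ℝ) + 1) ^ 2) := by
    intro k
    have hint : Integrable (D k) P := by
      refine Integrable.of_bound (C := ((k : ℝ) + 1) ^ 2) (hD k).aestronglyMeasurable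
        (ae_of_all _ fun ω => ?_)
      have h1 := average_mem_Icc (S := S) ((k + 1 + 1) ^ 4) ω
      have h2 := average_mem_Icc (S := S) ((k + 1) ^ 4) ω
      rw [Real.norm_of_nonneg (by positivity)]
      refine mul_le_of_le_one_right (by positivity) ?_
      rw [sq_le_one_iff_abs_le_one, abs_le]
      constructor <;> linarith [h1.1, h1.2, h2.1, h2.2]
    rw [← ofReal_integral_eq_lintegral_ofReal hint (ae_of_all _ fun ω => by positivity)]
    refine ENNReal.ofReal_le_ofReal ?_
    rw [integral_const_mul]
    have := integral_sq_sub_average_le hS hp (l := (k + 1) ^ 4) (m := (k + 1 + 1) ^ 4)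
      (by positivity) (by gcongr; omega)
    refine (mul_le_mul_of_nonneg_left this (by positivity)).trans_eq ?_
    push_cast
    field_simp
  have hfin : ∫⁻ ω, ∑' k, ENNReal.ofReal (D k ω) ∂P ≠ ∞ := by
    rw [lintegral_tsum fun k => (hD k).ennreal_ofReal.aemeasurable]
    refine ne_top_of_le_ne_top ?_ (ENNReal.tsum_le_tsum hDint)
    rw [← ENNReal.ofReal_tsum_of_nonneg (fun k => by positivity) hsummable]
    exact ENNReal.ofReal_ne_top
  have hae := ae_lt_top (Measurable.tsum fun k => (hD k).ennreal_ofReal) hfin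
  filter_upwards [hae] with ω hω
  have hDs : Summable fun k => D k ω := by
    have := ENNReal.summable_toReal hω.ne
    refine this.congr fun k => ?_
    exact ENNReal.toReal_ofReal (by positivity)
  have hdist : Summable fun k => dist (u k ω) (u (k + 1) ω) := by
    refine Summable.of_nonneg_of_le (fun _ => dist_nonneg) (fun k => ?_) (hDs.add hsummable)
    rw [dist_comm, Real.dist_eq]
    set x := |u (k + 1) ω - u k ω| with hx
    have hk : (0 : ℝ) < k + 1 := by positivity
    have h1 : D k ω = (((k : ℝ) + 1) * x) ^ 2 := by
      simp only [D, hx, mul_pow, sq_abs]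
    have h2 : 1 / ((k : ℝ) + 1) ^ 2 = (1 / ((k : ℝ) + 1)) ^ 2 := by simp
    have h3 : (((k : ℝ) + 1) * x) * (1 / ((k : ℝ) + 1)) = x := by field_simp
    have h4 : 0 ≤ x := abs_nonneg _
    rw [h1, h2]
    -- The inequality `2ab ≤ a² + b²` with `a = (k + 1) x` and `b = 1 / (k + 1)`, whose product is
    -- `x`.
    nlinarith [sq_nonneg ((((k : ℝ) + 1) * x) - (1 / ((k : ℝ) + 1))), h3]
  exact cauchySeq_tendsto_of_complete (cauchySeq_of_summable_dist hdist)

/-- The frequencies of events, all of whose finite intersections have a probability depending only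
on the number of events, converge almost surely, and the moments of the limit are the
probabilities of these intersections. -/
theorem exists_tendsto_average [IsProbabilityMeasure P] (hS : ∀ i, MeasurableSet (S i))
    (hp : ∀ A : Finset ℕ, P.real (⋂ i ∈ A, S i) = p A.card) :
    ∃ C : Ω → ℝ, Measurable C ∧
      (∀ᵐ ω ∂P, Tendsto (fun m : ℕ => (occurrences S m ω : ℝ) / m) atTop (𝓝 (C ω))) ∧
      (∀ᵐ ω ∂P, C ω ∈ Set.Icc (0 : ℝ) 1) ∧ ∀ k : ℕ, ∫ ω, C ω ^ k ∂P = p k := by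
  obtain ⟨C, hC, hlim⟩ := measurable_limit_of_tendsto_metrizable_ae (μ := P) (L := atTop)
    (f := fun (m : ℕ) ω => (occurrences S m ω : ℝ) / m)
    (fun m => ((measurable_occurrences hS m).div_const _).aemeasurable)
    (by
      filter_upwards [ae_exists_tendsto_subsequence hS hp] with ω hω
      obtain ⟨c, hc⟩ := hω
      exact ⟨c, tendsto_average_of_tendsto_subsequence hc⟩)
  refine ⟨C, hC, hlim, ?_, fun k => ?_⟩
  · filter_upwards [hlim] with ω hω
    exact isClosed_Icc.mem_of_tendsto hω (Eventually.of_forall fun m => average_mem_Icc m ω)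
  · have hdom : Tendsto (fun m : ℕ => ∫ ω, ((occurrences S m ω).choose k : ℝ) / m.choose k ∂P)
        atTop (𝓝 (∫ ω, C ω ^ k ∂P)) := by
      refine tendsto_integral_of_dominated_convergence (fun _ => 1) (fun m => ?_)
        (integrable_const 1) (fun m => ae_of_all _ fun ω => ?_) ?_
      · refine (Measurable.div_const ?_ _).aestronglyMeasurable
        simp only [choose_occurrences_eq_sum]
        exact Finset.measurable_sum _ fun A _ => measurable_one.indicator
          (A.measurableSet_biInter fun i _ => hS i)
      · rw [Real.norm_of_nonneg (by positivity)]
        refine div_le_one_of_le₀ ?_ (by positivity)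
        exact_mod_cast Nat.choose_le_choose k (occurrences_le m ω)
      · filter_upwards [hlim] with ω hω
        exact tendsto_choose_div hω k
    -- The approximating integrals are not merely close to `p k`: they equal it as soon as `m ≥ k`.
    refine tendsto_nhds_unique hdom (tendsto_const_nhds.congr' ?_)
    filter_upwards [eventually_ge_atTop k] with m hm
    have : (m.choose k : ℝ) ≠ 0 := by exact_mod_cast (Nat.choose_pos hm).ne'
    rw [integral_div, integral_choose_occurrences hS hp]
    field_simp

end Exchangeable

/-! ### Determinacy of the moment problem on the unit interval, by Weierstrass approximation. -/

section Moments

lemma integrable_of_continuous_of_ae_mem_Icc {μ : Measure ℝ} [IsFiniteMeasure μ]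
    (hμ : ∀ᵐ x ∂μ, x ∈ Set.Icc (0 : ℝ) 1) {f : ℝ → ℝ} (hf : Continuous f) : Integrable f μ := by
  obtain ⟨C, hC⟩ := isCompact_Icc.exists_bound_of_continuousOn (s := Set.Icc (0 : ℝ) 1)
    hf.continuousOn
  exact Integrable.of_bound hf.aestronglyMeasurable C (hμ.mono hC)

lemma integral_polynomial_eq_of_moments_eq {μ ν : Measure ℝ} [IsFiniteMeasure μ]
    [IsFiniteMeasure ν] (hμ : ∀ᵐ x ∂μ, x ∈ Set.Icc (0 : ℝ) 1)
    (hν : ∀ᵐ x ∂ν, x ∈ Set.Icc (0 : ℝ) 1)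
    (h : ∀ k : ℕ, ∫ x, x ^ k ∂μ = ∫ x, x ^ k ∂ν) (q : Polynomial ℝ) :
    ∫ x, q.eval x ∂μ = ∫ x, q.eval x ∂ν := by
  induction q using Polynomial.induction_on' with
  | add q₁ q₂ h₁ h₂ =>
    simp only [Polynomial.eval_add]
    rw [integral_add, integral_add, h₁, h₂] <;>
      first
      | exact integrable_of_continuous_of_ae_mem_Icc hμ (Polynomial.continuous _)
      | exact integrable_of_continuous_of_ae_mem_Icc hν (Polynomial.continuous _)
  | monomial k a => simp only [Polynomial.eval_monomial, integral_const_mul, h]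

/-- Probability measures on the unit interval are determined by their moments. -/
theorem ext_of_moments_eq {μ ν : Measure ℝ} [IsProbabilityMeasure μ] [IsProbabilityMeasure ν]
    (hμ : ∀ᵐ x ∂μ, x ∈ Set.Icc (0 : ℝ) 1) (hν : ∀ᵐ x ∂ν, x ∈ Set.Icc (0 : ℝ) 1)
    (h : ∀ k : ℕ, ∫ x, x ^ k ∂μ = ∫ x, x ^ k ∂ν) : μ = ν := by
  refine ext_of_forall_integral_eq_of_IsFiniteMeasure fun f => ?_
  refine eq_of_forall_dist_le fun ε hε => ?_
  obtain ⟨q, hq⟩ := exists_polynomial_near_of_continuousOn 0 1 f f.continuous.continuousOn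
    (ε / 2) (by positivity)
  have key : ∀ (m : Measure ℝ) [IsProbabilityMeasure m], (∀ᵐ x ∂m, x ∈ Set.Icc (0 : ℝ) 1) →
      |∫ x, f x ∂m - ∫ x, q.eval x ∂m| ≤ ε / 2 := by
    intro m _ hm
    rw [← integral_sub (integrable_of_continuous_of_ae_mem_Icc hm f.continuous)
      (integrable_of_continuous_of_ae_mem_Icc hm q.continuous), ← Real.norm_eq_abs]
    have := norm_integral_le_of_norm_le_const (μ := m) (f := fun x => f x - q.eval x)
      (C := ε / 2) (hm.mono fun x hx => by
        rw [Real.norm_eq_abs, abs_sub_comm]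
        exact (hq x hx).le)
    simpa using this
  have h1 := key μ hμ
  have h2 := key ν hν
  rw [integral_polynomial_eq_of_moments_eq hμ hν h q] at h1
  rw [Real.dist_eq, abs_le]
  rw [abs_le] at h1 h2
  constructor <;> linarith [h1.1, h1.2, h2.1, h2.2]

end Moments

/-! ### Moments of the beta law. -/

section Beta

lemma ae_mem_Icc_betaMeasure (a b : ℝ) : ∀ᵐ x ∂betaMeasure a b, x ∈ Set.Icc (0 : ℝ) 1 := by
  have hm : Measurable (betaPDF a b) := (measurable_betaPDFReal a b).ennreal_ofReal
  rw [betaMeasure, ae_withDensity_iff hm]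
  refine ae_of_all _ fun x hx => ?_
  by_contra hx'
  rw [Set.mem_Icc, not_and_or, not_le, not_le] at hx'
  rcases hx' with h | h
  · exact hx (betaPDF_eq_zero_of_nonpos h.le)
  · exact hx (betaPDF_eq_zero_of_one_le h.le)

/-- A factor `x ^ k` only shifts the first parameter, so each moment is a ratio of normalizing
constants. -/
lemma pow_mul_betaPDFReal {a b : ℝ} (ha : 0 < a) (hb : 0 < b) (k : ℕ) (x : ℝ) :
    x ^ k * betaPDFReal a b x = beta (a + k) b / beta a b * betaPDFReal (a + k) b x := by
  have h1 := (beta_pos ha hb).ne'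
  have h2 := (beta_pos (α := a + k) (by positivity) hb).ne'
  simp only [betaPDFReal]
  split_ifs with hx
  · rw [show a + k - 1 = a - 1 + k by ring, Real.rpow_add hx.1, Real.rpow_natCast]
    field_simp
  · simp

lemma betaPDFReal_nonneg {a b : ℝ} (ha : 0 < a) (hb : 0 < b) (x : ℝ) : 0 ≤ betaPDFReal a b x := by
  by_cases hx : 0 < x ∧ x < 1
  · exact (betaPDFReal_pos hx.1 hx.2 ha hb).le
  · simp [betaPDFReal, hx]

lemma integral_betaPDFReal {a b : ℝ} (ha : 0 < a) (hb : 0 < b) : ∫ x, betaPDFReal a b x = 1 := by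
  rw [integral_eq_lintegral_of_nonneg_ae (ae_of_all _ (betaPDFReal_nonneg ha hb))
    (measurable_betaPDFReal a b).aestronglyMeasurable]
  have := lintegral_betaPDF_eq_one ha hb
  simp only [betaPDF] at this
  rw [this, ENNReal.toReal_one]

lemma integral_pow_betaMeasure {a b : ℝ} (ha : 0 < a) (hb : 0 < b) (k : ℕ) :
    ∫ x, x ^ k ∂betaMeasure a b = beta (a + k) b / beta a b := by
  have hpdf : betaPDF a b = fun x => ENNReal.ofReal (betaPDFReal a b x) := rfl
  rw [betaMeasure, hpdf, integral_withDensity_eq_integral_toReal_smul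
    (measurable_betaPDFReal a b).ennreal_ofReal (ae_of_all _ fun _ => ENNReal.ofReal_lt_top)]
  simp only [ENNReal.toReal_ofReal (betaPDFReal_nonneg ha hb _), smul_eq_mul,
    mul_comm (betaPDFReal a b _), pow_mul_betaPDFReal ha hb]
  rw [integral_const_mul, integral_betaPDFReal (by positivity) hb, mul_one]

lemma beta_natCast_ratio (b g k : ℕ) :
    beta ((b + 1 : ℕ) + k) (g + 1 : ℕ) / beta (b + 1 : ℕ) (g + 1 : ℕ) =
      ((b + k).choose k : ℝ) / ((b + 1 + g + k).choose k : ℝ) := by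
  have e1 : (((b + 1 : ℕ) : ℝ) + k) = ((b + k : ℕ) : ℝ) + 1 := by push_cast; ring
  have e2 : ((b + k : ℕ) : ℝ) + 1 + (g + 1 : ℕ) = ((b + 1 + g + k : ℕ) : ℝ) + 1 := by
    push_cast; ring
  have e3 : ((b + 1 : ℕ) : ℝ) + (g + 1 : ℕ) = ((b + 1 + g : ℕ) : ℝ) + 1 := by push_cast; ring
  have e4 : ((b + 1 : ℕ) : ℝ) = (b : ℝ) + 1 := by push_cast; ring
  have e5 : ((g + 1 : ℕ) : ℝ) = (g : ℝ) + 1 := by push_cast; ring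
  rw [beta, beta, e1, e2, e3, e4, e5]
  simp only [Real.Gamma_nat_eq_factorial]
  have c1 : ((b + k).choose k : ℝ) * b.factorial * k.factorial = (b + k).factorial := by
    exact_mod_cast Nat.add_choose_mul_factorial_mul_factorial b k
  have c2 : ((b + 1 + g + k).choose k : ℝ) * (b + 1 + g).factorial * k.factorial =
      (b + 1 + g + k).factorial := by
    exact_mod_cast Nat.add_choose_mul_factorial_mul_factorial (b + 1 + g) k
  have h1 : ((b + 1 + g + k).choose k : ℝ) ≠ 0 := by
    exact_mod_cast (Nat.choose_pos (Nat.le_add_left _ _)).ne'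
  rw [← c1, ← c2]
  have := Nat.factorial_ne_zero
  field_simp

lemma isProbabilityMeasure_betaLaw {b : ℕ} (hb : 0 < b) (g : ℕ) :
    IsProbabilityMeasure (betaLaw b g) := by
  rw [betaLaw]
  split_ifs with hg
  · infer_instance
  · exact isProbabilityMeasureBeta (by exact_mod_cast hb)
      (by exact_mod_cast Nat.pos_of_ne_zero hg)

lemma ae_mem_Icc_betaLaw (b g : ℕ) : ∀ᵐ x ∂betaLaw b g, x ∈ Set.Icc (0 : ℝ) 1 := by
  rw [betaLaw]
  split_ifs with hg
  · rw [ae_dirac_eq]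
    simp
  · exact ae_mem_Icc_betaMeasure _ _

lemma integral_pow_betaLaw {b g n : ℕ} (hb : 0 < b) (hn : b + g = n + 1) (k : ℕ) :
    ∫ x, x ^ k ∂betaLaw b g = ((b + k - 1).choose k : ℝ) / ((n + k).choose k : ℝ) := by
  obtain ⟨b, rfl⟩ := Nat.exists_eq_succ_of_ne_zero hb.ne'
  rcases g with _ | g
  -- In the degenerate case the two binomial coefficients coincide, and every moment is 1, as for
  -- the point mass at 1.
  · obtain rfl : b = n := by omega
    have : ((b + k).choose k : ℝ) ≠ 0 := by
      exact_mod_cast (Nat.choose_pos (Nat.le_add_left _ _)).ne'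
    simp [betaLaw, Nat.succ_add_sub_one, this]
  · obtain rfl : n = b + 1 + g := by omega
    rw [betaLaw, if_neg (by omega), integral_pow_betaMeasure (by positivity) (by positivity),
      Nat.succ_add_sub_one]
    exact beta_natCast_ratio b g k

end Beta

/-! ### Ranks in an exchangeable vector without ties. -/

section Rank

variable {ι : Type*} [Fintype ι]

/-- The number of entries of `v` that are smaller than the `i`-th one. -/
noncomputable def rank (v : ι → ℝ≥0) (i : ι) : ℕ := (Finset.univ.filter fun j => v j < v i).card

lemma rank_lt_rank {v : ι → ℝ≥0} {i j : ι} (h : v i < v j) : rank v i < rank v j := by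
  refine Finset.card_lt_card (Finset.ssubset_iff_of_subset ?_ |>.2 ⟨i, ?_, ?_⟩)
  · exact fun l hl => by
      simp only [Finset.mem_filter, Finset.mem_univ, true_and] at hl ⊢
      exact hl.trans h
  · simpa using h
  · simp

lemma rank_lt_card (v : ι → ℝ≥0) (i : ι) : rank v i < Fintype.card ι :=
  Finset.card_lt_card (Finset.filter_ssubset.2 ⟨i, Finset.mem_univ i, lt_irrefl _⟩)

lemma rank_comp_equiv (v : ι → ℝ≥0) (π : Equiv.Perm ι) (i : ι) :
    rank (fun j => v (π j)) i = rank v (π i) := by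
  refine Finset.card_equiv π fun j => ?_
  simp

lemma rank_injective {v : ι → ℝ≥0} (hv : Function.Injective v) : Function.Injective (rank v) := by
  intro i j hij
  by_contra hne
  rcases lt_or_gt_of_ne (hv.ne hne) with h | h
  · exact (rank_lt_rank h).ne hij
  · exact (rank_lt_rank h).ne' hij

/-- Without ties, `rank v` is a bijection onto `0, …, Fintype.card ι - 1`. -/
lemma card_rank_lt {v : ι → ℝ≥0} (hv : Function.Injective v) {K : ℕ} (hK : K ≤ Fintype.card ι) :
    (Finset.univ.filter fun i => rank v i < K).card = K := by
  have himage : Finset.univ.image (rank v) = Finset.range (Fintype.card ι) := by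
    refine Finset.eq_of_subset_of_card_le (fun l hl => ?_) ?_
    · obtain ⟨i, -, rfl⟩ := Finset.mem_image.1 hl
      exact Finset.mem_range.2 (rank_lt_card v i)
    · rw [Finset.card_image_of_injective _ (rank_injective hv), Finset.card_range,
        Finset.card_univ]
  rw [← Finset.card_image_of_injective _ (rank_injective hv)]
  conv_rhs => rw [← Finset.card_range K]
  congr 1
  ext l
  simp only [Finset.mem_image, Finset.mem_filter, Finset.mem_univ, true_and, Finset.mem_range]
  refine ⟨fun ⟨i, hi, h⟩ => h ▸ hi, fun hl => ?_⟩
  obtain ⟨i, -, hi⟩ := Finset.mem_image.1 (himage ▸ Finset.mem_range.2 (hl.trans_le hK))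
  exact ⟨i, hi ▸ hl, hi⟩

lemma measurableSet_rank_lt (K : ℕ) (i : ι) : MeasurableSet {v : ι → ℝ≥0 | rank v i < K} := by
  have : Measurable fun v : ι → ℝ≥0 => rank v i := by
    simp only [rank, Finset.card_filter]
    refine Finset.measurable_sum _ fun j _ => Measurable.ite ?_ measurable_const measurable_const
    exact measurableSet_lt (measurable_pi_apply j) (measurable_pi_apply i)
  exact this measurableSet_Iio

lemma exists_perm_map_eq {A B : Finset ι} (h : A.card = B.card) :
    ∃ π : Equiv.Perm ι, ∀ i, i ∈ A ↔ π i ∈ B := by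
  classical
  obtain ⟨e⟩ : Nonempty ({i // i ∈ A} ≃ {i // i ∈ B}) := by
    rw [← Fintype.card_eq]
    simpa using h
  refine ⟨e.extendSubtype, fun i => ⟨fun hi => e.extendSubtype_mem i hi, fun hi => ?_⟩⟩
  by_contra hi'
  exact e.extendSubtype_not_mem i hi' hi

/-- If the random vector `R` is exchangeable and has almost surely distinct components, then the set
of the `K` components with the smallest values is a uniformly distributed `K`-set. -/
theorem measureReal_forall_rank_lt {Ω : Type*} [MeasurableSpace Ω] {P : Measure Ω}
    [IsProbabilityMeasure P] {R : ι → Ω → ℝ≥0} (hR : ∀ i, Measurable (R i))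
    (hexch : ∀ π : Equiv.Perm ι,
      IdentDistrib (fun ω i => R i ω) (fun ω i => R (π i) ω) P P)
    (hinj : ∀ᵐ ω ∂P, Function.Injective fun i => R i ω) {K : ℕ} (hK : K ≤ Fintype.card ι)
    (A : Finset ι) :
    P.real {ω | ∀ i ∈ A, rank (fun j => R j ω) i < K} =
      (K.choose A.card : ℝ) / ((Fintype.card ι).choose A.card : ℝ) := by
  classical
  have hV : ∀ B : Finset ι, MeasurableSet {v : ι → ℝ≥0 | ∀ i ∈ B, rank v i < K} := by
    intro B
    have : {v : ι → ℝ≥0 | ∀ i ∈ B, rank v i < K} = ⋂ i ∈ B, {v | rank v i < K} := by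
      ext v; simp
    rw [this]
    exact B.measurableSet_biInter fun i _ => measurableSet_rank_lt K i
  have hRm : Measurable fun ω i => R i ω := measurable_pi_lambda _ hR
  -- Exchangeability: a permutation carrying `B` onto `A` shows that the probability depends only on
  -- the cardinality.
  have hsymm : ∀ B : Finset ι, B.card = A.card →
      P.real {ω | ∀ i ∈ B, rank (fun j => R j ω) i < K} =
        P.real {ω | ∀ i ∈ A, rank (fun j => R j ω) i < K} := by
    intro B hB
    obtain ⟨π, hπ⟩ := exists_perm_map_eq hB
    have h := (hexch π).measure_mem_eq (hV B)
    rw [measureReal_def, measureReal_def]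
    congr 1
    refine h.trans ?_
    congr 1
    ext ω
    simp only [Set.mem_preimage, Set.mem_ofPred_eq, rank_comp_equiv (fun j => R j ω), hπ]
    exact ⟨fun h i hi => by simpa using h (π.symm i) (by simpa using hi), fun h i hi => h (π i) hi⟩
  -- Almost surely exactly `K` components have rank below `K`, so the number of sets `B` whose event
  -- occurs is constant; its expectation gives the sum.
  have hsum : ∑ B ∈ Finset.univ.powersetCard A.card,
      P.real {ω | ∀ i ∈ B, rank (fun j => R j ω) i < K} = K.choose A.card := by
    have hms : ∀ B : Finset ι, MeasurableSet {ω | ∀ i ∈ B, rank (fun j => R j ω) i < K} :=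
      fun B => hRm (hV B)
    simp only [← integral_indicator_one (hms _)]
    have hint : ∀ B ∈ Finset.univ.powersetCard A.card, Integrable
        ({ω | ∀ i ∈ B, rank (fun j => R j ω) i < K}.indicator (1 : Ω → ℝ)) P :=
      fun B _ => (integrable_const (1 : ℝ)).indicator (hms B)
    rw [← integral_finsetSum _ hint]
    have : ∀ᵐ ω ∂P, ∑ B ∈ Finset.univ.powersetCard A.card,
        {ω | ∀ i ∈ B, rank (fun j => R j ω) i < K}.indicator (1 : Ω → ℝ) ω =
          K.choose A.card := by
      filter_upwards [hinj] with ω hω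
      simp only [Set.indicator_apply, Pi.one_apply, Finset.sum_boole, Set.mem_ofPred_eq]
      rw [Nat.cast_inj]
      conv_rhs => rw [← card_rank_lt hω hK, ← Finset.card_powersetCard]
      congr 1
      ext B
      simp only [Finset.mem_powersetCard, Finset.mem_filter, Finset.subset_iff, Finset.mem_univ]
      grind
    rw [integral_congr_ae this]
    simp
  rw [Finset.sum_congr rfl fun B hB => hsymm B (Finset.mem_powersetCard.1 hB).2] at hsum
  rw [Finset.sum_const, Finset.card_powersetCard, Finset.card_univ, nsmul_eq_mul] at hsum
  have : ((Fintype.card ι).choose A.card : ℝ) ≠ 0 := by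
    exact_mod_cast (Nat.choose_pos (Finset.card_le_univ A)).ne'
  rw [← hsum]
  field_simp

end Rank

/-- A permutation of `B` extends by the identity to an initial segment of indices containing `B`,
where exchangeability is assumed. -/
lemma Exchangeable.identDistrib_comp_perm {Ω T : Type*} [MeasurableSpace Ω] [MeasurableSpace T]
    {O : ℕ → Ω → T} {P : Measure Ω} (h : Exchangeable O P) (B : Finset ℕ) (π : Equiv.Perm B) :
    IdentDistrib (fun ω (i : B) => O i ω) (fun ω (i : B) => O (π i) ω) P P := by
  classical
  let N := B.sup id + 1
  have hN : ∀ i ∈ B, i < N := fun i hi => Nat.lt_succ_of_le (Finset.le_sup (f := id) hi)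
  let f : B ↪ Fin N := ⟨fun i => ⟨i, hN i i.2⟩, fun i j hij => Subtype.ext (by simpa using hij)⟩
  have hmeas : Measurable fun (o : Fin N → T) (i : B) => o (f i) :=
    measurable_pi_lambda _ fun i => measurable_pi_apply (f i)
  have := (h N (π.viaFintypeEmbedding f)).comp hmeas
  have hπ : (fun ω (i : B) => O (π i) ω) = (fun (o : Fin N → T) (i : B) => o (f i)) ∘
      fun ω i => O (π.viaFintypeEmbedding f i) ω := by
    funext ω i
    change _ = O (π.viaFintypeEmbedding f (f i)) ω
    rw [Equiv.Perm.viaFintypeEmbedding_apply_image]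
    rfl
  rw [hπ]
  exact this

/-! ### Joint probability of covering several future responses. -/

section Coverage

variable {Ω : Type*}

/-- The event that fewer than `b` of `R 0, …, R (n - 1)` are at most `R (n + i)`. -/
def lowRank (R : ℕ → Ω → ℝ≥0) (n b i : ℕ) : Set Ω :=
  {ω | ((Finset.range n).filter fun j => R j ω ≤ R (n + i) ω).card < b}

lemma measurableSet_lowRank [MeasurableSpace Ω] {R : ℕ → Ω → ℝ≥0} (hR : ∀ i, Measurable (R i))
    (n b i : ℕ) : MeasurableSet (lowRank R n b i) := by
  have : Measurable fun ω => ((Finset.range n).filter fun j => R j ω ≤ R (n + i) ω).card := by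
    simp only [Finset.card_filter]
    exact Finset.measurable_sum _ fun j _ =>
      Measurable.ite (measurableSet_le (hR _) (hR _)) measurable_const measurable_const
  exact this measurableSet_Iio

/-- All terms of `v` with indices in `A` have rank below `b` with respect to the terms with indices
in `C` if and only if they have rank below `b + #A - 1` with respect to all these terms. -/
lemma forall_card_lt_iff {v : ℕ → ℝ≥0} {C A : Finset ℕ} (hCA : Disjoint C A)
    (hv : Function.Injective v) (b : ℕ) :
    (∀ i ∈ A, (C.filter fun j => v j ≤ v i).card < b) ↔
      ∀ i ∈ A, ((C ∪ A).filter fun j => v j < v i).card < b + A.card - 1 := by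
  have hC : ∀ i ∈ A, (C.filter fun j => v j ≤ v i) = C.filter fun j => v j < v i := by
    intro i hi
    refine Finset.filter_congr fun j hj => ⟨fun h => lt_of_le_of_ne h fun he => ?_, le_of_lt⟩
    exact Finset.disjoint_left.1 hCA hj (hv he ▸ hi)
  have hsplit : ∀ i, ((C ∪ A).filter fun j => v j < v i).card =
      (C.filter fun j => v j < v i).card + (A.filter fun j => v j < v i).card := by
    intro i
    rw [Finset.filter_union, Finset.card_union_of_disjoint]
    exact Finset.disjoint_filter_filter hCA
  constructor
  · intro h i hi
    have h1 := h i hi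
    rw [hC i hi] at h1
    have h2 : (A.filter fun j => v j < v i).card < A.card :=
      Finset.card_lt_card (Finset.filter_ssubset.2 ⟨i, hi, lt_irrefl _⟩)
    rw [hsplit]
    omega
  · intro h i hi
    -- The largest term of `A` has precisely the other `A.card - 1` terms of `A` below it, so its
    -- bound forces fewer than `b` terms of `C` below it, and a fortiori below every other term of
    -- `A`.
    obtain ⟨l, hl, hmax⟩ := A.exists_max_image v ⟨i, hi⟩
    have h1 := h l hl
    have h2 : (A.filter fun j => v j < v l) = A.erase l := by
      ext j
      simp only [Finset.mem_filter, Finset.mem_erase]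
      refine ⟨fun ⟨hj, hlt⟩ => ⟨fun he => hlt.ne (he ▸ rfl), hj⟩, fun ⟨hne, hj⟩ => ⟨hj, ?_⟩⟩
      exact lt_of_le_of_ne (hmax j hj) (hv.ne hne)
    have h3 : 0 < A.card := Finset.card_pos.2 ⟨l, hl⟩
    rw [hsplit, h2, Finset.card_erase_of_mem hl] at h1
    refine lt_of_le_of_lt (Finset.card_le_card (t := C.filter fun j => v j < v l) ?_)
      (by omega)
    rw [hC i hi]
    intro j
    simp only [Finset.mem_filter]
    exact fun ⟨hj, hlt⟩ => ⟨hj, hlt.trans_le (hmax i hi)⟩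

lemma rank_coe_finset (v : ℕ → ℝ≥0) (B : Finset ℕ) (i : B) :
    rank (fun j : B => v j) i = (B.filter fun j => v j < v i).card := by
  rw [rank, ← Finset.card_map (Function.Embedding.subtype _)]
  congr 1
  ext j
  simp [and_comm]

/-- The uniform law of the low-ranked set is applied to the calibration scores together with the
scores indexed by `A`, with `K = b + A.card - 1` supplied by `forall_card_lt_iff`. -/
theorem measureReal_iInter_lowRank [MeasurableSpace Ω] {P : Measure Ω} [IsProbabilityMeasure P]
    {R : ℕ → Ω → ℝ≥0} (hR : ∀ i, Measurable (R i)) (hexch : Exchangeable R P)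
    (hinj : ∀ᵐ ω ∂P, Function.Injective fun i => R i ω) {n b : ℕ} (hb : 0 < b) (hbn : b ≤ n + 1)
    (A : Finset ℕ) :
    P.real (⋂ i ∈ A, lowRank R n b i) =
      ((b + A.card - 1).choose A.card : ℝ) / ((n + A.card).choose A.card : ℝ) := by
  rcases A.eq_empty_or_nonempty with rfl | hA
  · simp
  have hApos := hA.card_pos
  let A' : Finset ℕ := A.map (addLeftEmbedding n)
  have hdisj : Disjoint (Finset.range n) A' := by
    rw [Finset.disjoint_left]
    intro j hj hj'
    obtain ⟨i, -, rfl⟩ := Finset.mem_map.1 hj'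
    simp at hj
  have hA' : A'.card = A.card := Finset.card_map _
  let B : Finset ℕ := Finset.range n ∪ A'
  have hB : Fintype.card B = n + A.card := by
    rw [Fintype.card_coe, Finset.card_union_of_disjoint hdisj, Finset.card_range, hA']
  let A'' : Finset B := A'.subtype (· ∈ B)
  have hA'' : A''.card = A.card := by
    rw [← hA', Finset.card_subtype, Finset.filter_true_of_mem]
    exact fun i hi => Finset.mem_union_right _ hi
  have key := measureReal_forall_rank_lt (R := fun (i : B) => R i) (P := P) (fun i => hR i)
    (fun π => hexch.identDistrib_comp_perm B π)
    (hinj.mono fun ω hω => hω.comp Subtype.val_injective)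
    (K := b + A.card - 1) (by omega) A''
  rw [hA'', hB] at key
  rw [← key]
  refine measureReal_congr ?_
  filter_upwards [hinj] with ω hω
  refine propext ?_
  have h1 : (⋂ i ∈ A, lowRank R n b i) ω ↔
      ∀ i ∈ A', ((Finset.range n).filter fun j => R j ω ≤ R i ω).card < b := by
    change ω ∈ (⋂ i ∈ A, lowRank R n b i) ↔ _
    simp [A', lowRank]
  rw [h1, forall_card_lt_iff hdisj hω b, hA']
  change _ ↔ ∀ i ∈ A'', rank (fun j : B => R j ω) i < b + A.card - 1
  simp only [rank_coe_finset (fun j => R j ω)]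
  constructor
  · exact fun h i hi => h i (Finset.mem_subtype.1 hi)
  · exact fun h i hi => h ⟨i, Finset.mem_union_right _ hi⟩ (Finset.mem_subtype.2 hi)

end Coverage

lemma coe_lt_orderStat_iff {n : ℕ} (v : Fin n → ℝ≥0) (x : ℝ≥0) {b : ℕ} (hb : 0 < b)
    (hbn : b ≤ n + 1) :
    (x : ℝ≥0∞) < orderStat v b ↔ (Finset.univ.filter fun j => v j ≤ x).card < b := by
  rw [orderStat]
  split_ifs with h
  · have h1 := Tuple.lt_card_le_iff_apply_le_of_monotone (a := x) (j := ⟨b - 1, h⟩)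
      (Tuple.monotone_sort v)
    have h2 : (Finset.univ.filter fun j => (v ∘ Tuple.sort v) j ≤ x).card =
        (Finset.univ.filter fun j => v j ≤ x).card :=
      Finset.card_equiv (Tuple.sort v) fun j => by simp
    rw [h2] at h1
    rw [ENNReal.coe_lt_coe, ← not_le]
    simp only [Function.comp_apply] at h1
    rw [← h1]
    omega
  -- Here `b = n + 1`: the threshold is infinite and both sides always hold.
  · have : (Finset.univ.filter fun j => v j ≤ x).card ≤ n :=
      (Finset.card_le_univ _).trans_eq (Fintype.card_fin n)
    simp only [ENNReal.coe_lt_top, true_iff]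
    omega

/-! ### From the data to the scores. -/

section Scores

variable {Ω : Type*} {d : ℕ} {X : ℕ → Ω → EuclideanSpace ℝ (Fin d)} {Y : ℕ → Ω → ℝ} {r : ℕ}
  {ρ : EuclideanSpace ℝ (Fin d) → ℝ → Ω → ℝ≥0}

/-- Doob–Dynkin factorization: the product σ-field is generated by the map that keeps `(x, y)` and
replaces ω by its training sample. -/
lemma IsConformityFunction.exists_eq_comp (hρ : IsConformityFunction (trainingSigma X Y r) ρ) :
    ∃ F : (EuclideanSpace ℝ (Fin d) × ℝ) × (Fin r → EuclideanSpace ℝ (Fin d) × ℝ) → ℝ≥0,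
      Measurable F ∧ ∀ x y ω, ρ x y ω = F ((x, y), fun i => (X i ω, Y i ω)) := by
  let f : (EuclideanSpace ℝ (Fin d) × ℝ) × Ω →
      (EuclideanSpace ℝ (Fin d) × ℝ) × (Fin r → EuclideanSpace ℝ (Fin d) × ℝ) :=
    fun p => (p.1, fun i => (X i p.2, Y i p.2))
  have hcomap : MeasurableSpace.prod
      (inferInstance : MeasurableSpace (EuclideanSpace ℝ (Fin d) × ℝ)) (trainingSigma X Y r) =
      MeasurableSpace.comap f inferInstance := by
    change _ = MeasurableSpace.comap f (MeasurableSpace.prod _ _)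
    simp only [MeasurableSpace.prod, MeasurableSpace.comap_sup, MeasurableSpace.comap_comp]
    rfl
  rw [IsConformityFunction, hcomap] at hρ
  obtain ⟨F, hF, h⟩ := hρ.exists_eq_measurable_comp
  exact ⟨F, hF, fun x y ω => congrFun h ((x, y), ω)⟩

lemma coverIndicator_eq_indicator {n b : ℕ} {α : ℝ} (hα : ⌈(1 - α) * ((n : ℝ) + 1)⌉₊ = b)
    (hb : 0 < b) (hbn : b ≤ n + 1) (i : ℕ) (ω : Ω) :
    coverIndicator X Y r ρ n α i ω = (lowRank (score X Y r ρ) n b i).indicator 1 ω := by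
  classical
  rw [coverIndicator, Set.indicator_apply, Pi.one_apply]
  refine if_congr ?_ rfl rfl
  rw [predictionSet, Set.mem_ofPred_eq, hα, coe_lt_orderStat_iff _ _ hb hbn, lowRank,
    Set.mem_ofPred_eq]
  have : (Finset.univ.filter fun j : Fin n => score X Y r ρ j ω ≤ score X Y r ρ (n + i) ω).card =
      ((Finset.range n).filter fun j => score X Y r ρ j ω ≤ score X Y r ρ (n + i) ω).card := by
    rw [Finset.card_filter, Finset.card_filter, Finset.sum_range]
  rw [← this, score, ← add_assoc]

variable [MeasurableSpace Ω] {P : Measure Ω}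

lemma measurable_score (hX : ∀ i, Measurable (X i)) (hY : ∀ i, Measurable (Y i))
    (hρ : IsConformityFunction (trainingSigma X Y r) ρ) (i : ℕ) :
    Measurable (score X Y r ρ i) := by
  obtain ⟨F, hF, h⟩ := hρ.exists_eq_comp
  have : score X Y r ρ i = fun ω =>
      F ((X (r + i) ω, Y (r + i) ω), fun j : Fin r => (X j ω, Y j ω)) := by
    funext ω
    exact h _ _ _
  rw [this]
  exact hF.comp (((hX _).prodMk (hY _)).prodMk
    (measurable_pi_lambda _ fun j => (hX j).prodMk (hY j)))

/-- A permutation of the scores is induced by a permutation of the data that fixes the training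
block, and the latter is all that `F` sees besides the pair itself. -/
lemma exchangeable_score (hexch : Exchangeable (fun i ω => (X i ω, Y i ω)) P)
    (hρ : IsConformityFunction (trainingSigma X Y r) ρ) :
    Exchangeable (score X Y r ρ) P := by
  obtain ⟨F, hF, h⟩ := hρ.exists_eq_comp
  intro N π
  let τ : Equiv.Perm (Fin (r + N)) :=
    finSumFinEquiv.permCongr (Equiv.sumCongr (Equiv.refl (Fin r)) π)
  let G : (Fin (r + N) → EuclideanSpace ℝ (Fin d) × ℝ) → Fin N → ℝ≥0 :=
    fun o i => F (o (Fin.natAdd r i), fun j => o (Fin.castAdd N j))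
  have hG : Measurable G := by
    refine measurable_pi_lambda _ fun i => hF.comp ?_
    exact (measurable_pi_apply _).prodMk (measurable_pi_lambda _ fun j => measurable_pi_apply _)
  convert (hexch (r + N) τ).comp hG using 1
  · funext ω i
    simp [G, score, h]
  · funext ω i
    simp [G, score, h, τ, Equiv.permCongr_apply]

end Scores

/-- Rounding up `n + 1 - t` amounts to subtracting the floor of `t`, here with `t = α (n + 1)`. This
is what matches the beta parameters with the `n + k` in the coverage probabilities. -/
lemma ceil_add_floor_eq {α : ℝ} (hα0 : 0 < α) (hα1 : α < 1) (n : ℕ) :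
    ⌈(1 - α) * ((n : ℝ) + 1)⌉₊ + ⌊α * ((n : ℝ) + 1)⌋₊ = n + 1 := by
  have hle : ⌊α * ((n : ℝ) + 1)⌋₊ ≤ n + 1 := by
    refine Nat.floor_le_of_le ?_
    push_cast
    nlinarith
  have h0 : 0 ≤ α * ((n : ℝ) + 1) := by positivity
  have h : ⌈(1 - α) * ((n : ℝ) + 1)⌉₊ = n + 1 - ⌊α * ((n : ℝ) + 1)⌋₊ := by
    refine le_antisymm ?_ ?_
    · rw [Nat.ceil_le, Nat.cast_sub hle]
      push_cast
      linarith [Nat.floor_le h0]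
    · have h1 := Nat.le_ceil ((1 - α) * ((n : ℝ) + 1))
      have h2 := Nat.lt_floor_add_one (α * ((n : ℝ) + 1))
      have h3 : ((n + 1 : ℕ) : ℝ) <
          ((⌈(1 - α) * ((n : ℝ) + 1)⌉₊ + ⌊α * ((n : ℝ) + 1)⌋₊ + 1 : ℕ) : ℝ) := by
        push_cast
        linarith
      have h4 := Nat.cast_lt.1 h3
      omega
  omega

end SplitConformal

theorem theorem2 {Ω : Type*} [MeasurableSpace Ω] (P : Measure Ω) [IsProbabilityMeasure P]
    (d r : ℕ)
    (X : ℕ → Ω → EuclideanSpace ℝ (Fin d)) (Y : ℕ → Ω → ℝ)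
    (hX : ∀ i, Measurable (X i)) (hY : ∀ i, Measurable (Y i))
    (hexch : SplitConformal.Exchangeable (fun i ω => (X i ω, Y i ω)) P)
    (ρ : EuclideanSpace ℝ (Fin d) → ℝ → Ω → ℝ≥0)
    (hρ : SplitConformal.IsConformityFunction (SplitConformal.trainingSigma X Y r) ρ)
    (hdistinct : ∀ᵐ ω ∂P, ∀ i j : ℕ, i ≠ j →
      SplitConformal.score X Y r ρ i ω ≠ SplitConformal.score X Y r ρ j ω)
    (α : ℝ) (hα0 : 0 < α) (hα1 : α < 1) (n : ℕ) (hn : 1 ≤ n) :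
    ∃ Cinf : Ω → ℝ, Measurable Cinf ∧
      (∀ᵐ ω ∂P, Tendsto (fun m : ℕ => SplitConformal.coverage X Y r ρ n α m ω) atTop
        (𝓝 (Cinf ω))) ∧
      P.map Cinf =
        SplitConformal.betaLaw ⌈(1 - α) * ((n : ℝ) + 1)⌉₊ ⌊α * ((n : ℝ) + 1)⌋₊ := by
  open SplitConformal in
  have hbg := ceil_add_floor_eq hα0 hα1 n
  have hb : 0 < ⌈(1 - α) * ((n : ℝ) + 1)⌉₊ :=
    Nat.ceil_pos.2 (mul_pos (by linarith) (by positivity))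
  have hbn : ⌈(1 - α) * ((n : ℝ) + 1)⌉₊ ≤ n + 1 := by omega
  generalize hbdef : ⌈(1 - α) * ((n : ℝ) + 1)⌉₊ = b at hbg hb hbn ⊢
  generalize ⌊α * ((n : ℝ) + 1)⌋₊ = g at hbg ⊢
  have hR := measurable_score hX hY hρ
  obtain ⟨C, hC, hlim, hmem, hmom⟩ := exists_tendsto_average
    (p := fun k => ((b + k - 1).choose k : ℝ) / ((n + k).choose k : ℝ))
    (measurableSet_lowRank hR n b)
    (measureReal_iInter_lowRank hR (exchangeable_score hexch hρ)
      (hdistinct.mono fun ω hω i j hij => by_contra fun hne => hω i j hne hij) hb hbn)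
  refine ⟨C, hC, ?_, ?_⟩
  · filter_upwards [hlim] with ω hω
    refine hω.congr fun m => ?_
    rw [coverage, occurrences_eq_sum, div_eq_inv_mul, one_div]
    simp only [coverIndicator_eq_indicator hbdef hb hbn]
  · have := isProbabilityMeasure_betaLaw hb g
    have := Measure.isProbabilityMeasure_map (μ := P) hC.aemeasurable
    refine ext_of_moments_eq ?_ (ae_mem_Icc_betaLaw b g) fun k => ?_
    · exact (ae_map_iff hC.aemeasurable measurableSet_Icc).2 hmem
    · rw [integral_map hC.aemeasurable (by fun_prop), hmom, integral_pow_betaLaw hb hbg]
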